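/- Let $1\le p\le n$ be integers and let $\Omega\subset\mathbb R^n$ be a bounded open set with smooth boundary, i.e. every point of $\partial\Omega$ has an open neighborhood $B$ and a function $\rho\in C^\infty(B)$ such that $\Omega\cap B=\{\rho<0\}$, $\partial\Omega\cap B=\{\rho=0\}$ and $d\rho\neq0$ on $\partial\Omega\cap B$. For an open set $X\subset\mathbb R^n$, a function $u\in C^\infty(X)$ is called $p$-plurisubharmonic if for every $x\in X$ and every $p$-dimensional linear subspace $W\subset\mathbb R^n$ the trace of the restriction to $W$ of the Hessian $D^2_xu$ is $\ge 0$. For a compact set $K\subset X$, the $p$-convex hull of $K$ in $X$ is $$\widehat K_X=\{x\in X:\ u(x)\le \sup_K u\ \text{ for all smooth } p\text{-plurisubharmonic functions } u \text{ on } X\}$$ (with $\sup_\emptyset u=-\infty$), and $X$ is called $p$-convex if $\widehat K_X$ is compact for every compact $K\subset X$. The set $\Omega$ is called locally $p$-convex if every $x\in\partial\Omega$ has an open neighborhood $U$ in $\mathbb R^n$ such that $\Omega\cap U$ is $p$-convex. **Theorem.** If $\Omega$ is locally $p$-convex, then $\Omega$ is $p$-convex. -/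

import Mathlib

open scoped ContDiff

noncomputable section

namespace PGeom

/-- The trace `tr_W B` of the restriction to a subspace `W` of a bilinear form `B` on Euclidean
space, i.e. the sum of the diagonal values of `B` over an orthonormal basis of `W`
(`traceOn_eq_sum` shows that the basis does not matter). -/
def traceOn {n : ℕ} (B : EuclideanSpace ℝ (Fin n) →L[ℝ] EuclideanSpace ℝ (Fin n) →L[ℝ] ℝ)
    (W : Submodule ℝ (EuclideanSpace ℝ (Fin n))) : ℝ :=
  ∑ i, B (stdOrthonormalBasis ℝ W i) (stdOrthonormalBasis ℝ W i)

theorem traceOn_eq_sum {n : ℕ} {ι : Type*} [Fintype ι]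
    (B : EuclideanSpace ℝ (Fin n) →L[ℝ] EuclideanSpace ℝ (Fin n) →L[ℝ] ℝ)
    (W : Submodule ℝ (EuclideanSpace ℝ (Fin n))) (b : OrthonormalBasis ι ℝ W) :
    traceOn B W = ∑ i, B (b i) (b i) := by
  set s := stdOrthonormalBasis ℝ W with hs
  let T : W →ₗ[ℝ] W := ∑ i, LinearMap.smulRight
    (((B.flip (s i : EuclideanSpace ℝ (Fin n))) : EuclideanSpace ℝ (Fin n) →ₗ[ℝ] ℝ).comp W.subtype)
    (s i)
  have hT : ∀ v w : W, inner ℝ v (T w) = B w v := by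
    intro v w
    have h1 : (v : EuclideanSpace ℝ (Fin n)) = ∑ i, inner ℝ (s i) v • (s i : EuclideanSpace ℝ (Fin n)) := by
      conv_lhs => rw [← s.sum_repr' v]
      simp
    conv_rhs => rw [h1]
    simp only [T, LinearMap.sum_apply, inner_sum, LinearMap.smulRight_apply, map_sum, map_smul,
      inner_smul_right, smul_eq_mul]
    refine Finset.sum_congr rfl fun i _ => ?_
    rw [real_inner_comm v (s i), mul_comm]
    rfl
  have e1 := LinearMap.trace_eq_sum_inner T s
  have e2 := LinearMap.trace_eq_sum_inner T b
  simp only [hT] at e1 e2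
  rw [← e2, e1]
  rfl

/-- A bilinear form is `p`-positive if its trace on every `p`-dimensional subspace is `≥ 0`. -/
def PPositive {n : ℕ} (p : ℕ)
    (B : EuclideanSpace ℝ (Fin n) →L[ℝ] EuclideanSpace ℝ (Fin n) →L[ℝ] ℝ) : Prop :=
  ∀ W : Submodule ℝ (EuclideanSpace ℝ (Fin n)), Module.finrank ℝ W = p → 0 ≤ traceOn B W

/-- `u` is a smooth `p`-plurisubharmonic function on the open set `X`: it is `C^∞` on `X` and its
Hessian is `p`-positive at each point of `X`. Values of `u` outside `X` are irrelevant. -/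
def SmoothPSH {n : ℕ} (p : ℕ) (X : Set (EuclideanSpace ℝ (Fin n)))
    (u : EuclideanSpace ℝ (Fin n) → ℝ) : Prop :=
  ContDiffOn ℝ ∞ u X ∧ ∀ x ∈ X, PPositive p (fderiv ℝ (fderiv ℝ u) x)

/-- The `p`-convex hull of `K` in the open set `X`: the points `x` of `X` with `u x ≤ sup_K u` for
all smooth `p`-plurisubharmonic `u` on `X`. The supremum is taken in `[-∞, ∞]`, so that
`sup_∅ u = -∞`. -/
def pHull {n : ℕ} (p : ℕ) (X K : Set (EuclideanSpace ℝ (Fin n))) :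
    Set (EuclideanSpace ℝ (Fin n)) :=
  {x | x ∈ X ∧ ∀ u : EuclideanSpace ℝ (Fin n) → ℝ, SmoothPSH p X u →
    (u x : EReal) ≤ ⨆ y ∈ K, (u y : EReal)}

/-- The open set `X` is `p`-convex if the `p`-convex hull in `X` of each compact subset of `X` is
compact. -/
def PConvex {n : ℕ} (p : ℕ) (X : Set (EuclideanSpace ℝ (Fin n))) : Prop :=
  ∀ K : Set (EuclideanSpace ℝ (Fin n)), K ⊆ X → IsCompact K → IsCompact (pHull p X K)

/-- The open set `Ω` is locally `p`-convex if each boundary point has an open neighbourhood `U` in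
Euclidean space such that `Ω ∩ U` is `p`-convex. -/
def LocallyPConvex {n : ℕ} (p : ℕ) (Ω : Set (EuclideanSpace ℝ (Fin n))) : Prop :=
  ∀ x ∈ frontier Ω, ∃ U : Set (EuclideanSpace ℝ (Fin n)),
    IsOpen U ∧ x ∈ U ∧ PConvex p (Ω ∩ U)

/-- The open set `Ω` has smooth boundary: near each boundary point there is a local defining
function, i.e. a smooth `ρ` on an open neighbourhood `B` with `Ω ∩ B = {ρ < 0}`,
`∂Ω ∩ B = {ρ = 0}` and `dρ ≠ 0` on `∂Ω ∩ B`. -/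
def HasSmoothBoundary {n : ℕ} (Ω : Set (EuclideanSpace ℝ (Fin n))) : Prop :=
  ∀ x ∈ frontier Ω, ∃ (B : Set (EuclideanSpace ℝ (Fin n))) (ρ : EuclideanSpace ℝ (Fin n) → ℝ),
    IsOpen B ∧ x ∈ B ∧ ContDiffOn ℝ ∞ ρ B ∧
    Ω ∩ B = {y | y ∈ B ∧ ρ y < 0} ∧
    frontier Ω ∩ B = {y | y ∈ B ∧ ρ y = 0} ∧
    ∀ y ∈ frontier Ω ∩ B, fderiv ℝ ρ y ≠ 0

end PGeom

end

/-! Local `p`-convexity serves only to give an infinitesimal boundary condition: for a global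
defining function `ρ`, the trace of `D²ρ` on each `p`-plane tangent to `∂Ω` is nonnegative
(`IsDefiningFunction.sum_hessian_nonneg`). If it were negative on a tangent plane at `x₀`, it would
stay negative after adding a small multiple of `‖x - x₀‖²` and, once the plane is tilted into the
kernel of the differential, at all nearby points. The maximum principle (`mem_pHull_of_barrier`)
then puts points tending to `x₀` into the hull of one fixed compact subset of `Ω ∩ U`, so that this
hull is not compact.

Conversely the boundary condition suffices (`IsDefiningFunction.pConvex`). Comparing a point of `Ω`
near `∂Ω` with a boundary point at distance `O(|ρ|)` bounds the trace of `D²ρ` on any frame `w`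
below by `-C (|ρ| + ∑ |dρ(wᵢ)|)` (`IsDefiningFunction.exists_sum_hessian_ge`). In the Hessian of
`-log(-ρ) + A‖x‖²` the squares `(dρ(wᵢ)/ρ)²` and the quadratic term absorb this loss, so this
function is `p`-plurisubharmonic near `∂Ω`, where it tends to infinity. Composing with a smooth
convex nondecreasing function, flat up to a bound for the values on the rest of `Ω`, gives a
`p`-plurisubharmonic function on all of `Ω` that blows up at the boundary; hulls of compact sets
therefore stay away from `∂Ω`. -/

open scoped ContDiff Topology

noncomputable section

namespace PGeom

/-! ### Traces over orthonormal frames close to a hyperplane -/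

section Frames

variable {E : Type*} [NormedAddCommGroup E] [InnerProductSpace ℝ E] {ι : Type*} [Fintype ι]

/-- An orthonormal frame can be rotated into the hyperplane orthogonal to a unit vector `ν`,
moving each vector by at most twice its component along `ν`. -/
theorem exists_orthonormal_perp_near {w : ι → E} (hw : Orthonormal ℝ w) {ν : E} (hν : ‖ν‖ = 1)
    (hs : ∑ i, (inner ℝ ν (w i)) ^ 2 < 1) :
    ∃ w' : ι → E, Orthonormal ℝ w' ∧ (∀ i, inner ℝ ν (w' i) = 0) ∧
      ∀ i, ‖w' i - w i‖ ≤ 2 * |inner ℝ ν (w i)| := by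
  classical
  set s : ι → ℝ := fun i => inner ℝ ν (w i) with hsdef
  set q : E := ∑ i, s i • w i with hq
  set k : ℝ := √(1 - ∑ i, s i ^ 2) with hk
  have hkpos : 0 < k := Real.sqrt_pos.2 (by simpa [hsdef] using hs)
  have hk2 : k * k = 1 - ∑ i, s i ^ 2 := Real.mul_self_sqrt (by linarith)
  have hqw : ∀ j, inner ℝ q (w j) = s j := fun j => by
    simpa [hq] using hw.inner_left_fintype s j
  have hνν : inner ℝ ν ν = 1 := by rw [real_inner_self_eq_norm_sq, hν]; norm_num
  have hνq : inner ℝ ν q = ∑ i, s i ^ 2 := by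
    simp [hq, inner_sum, inner_smul_right, hsdef, pow_two]
  have hqq : inner ℝ q q = ∑ i, s i ^ 2 := by
    change inner ℝ q (∑ i, s i • w i) = _
    simp only [inner_sum, inner_smul_right, hqw, pow_two]
  set a : E := k⁻¹ • (ν - q) with ha
  have haw : ∀ j, inner ℝ a (w j) = 0 := fun j => by
    simp [ha, inner_smul_left, inner_sub_left, hqw, hsdef]
  have hνa : inner ℝ ν a = k := by
    rw [ha, inner_smul_right, inner_sub_right, hνν, hνq, ← hk2]
    field_simp
  have haa : inner ℝ a a = 1 := by
    rw [ha, inner_smul_right, inner_smul_left, inner_sub_right, inner_sub_left, inner_sub_left,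
      hνν, hνq, hqq, real_inner_comm, hνq]
    have : (1 - ∑ i, s i ^ 2 - (∑ i, s i ^ 2 - ∑ i, s i ^ 2)) = k * k := by rw [hk2]; ring
    rw [this]
    simp
    field_simp
  have hna : ‖a‖ = 1 := by
    have := real_inner_self_eq_norm_sq a
    rw [haa] at this
    nlinarith [norm_nonneg a]
  have hwi : ∀ i j, inner ℝ (w i) (w j) = if i = j then (1 : ℝ) else 0 :=
    orthonormal_iff_ite.1 hw
  -- The image of `w` under the reflection in the hyperplane orthogonal to `a + ν`: it sends `a` to
  -- `-ν`, and `a` is orthogonal to every `w i`.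
  refine ⟨fun i => w i - (s i / (1 + k)) • (a + ν), ?_, ?_, ?_⟩
  · rw [orthonormal_iff_ite]
    intro i j
    have h1 : ∀ j, inner ℝ (w j) ν = s j := fun j => real_inner_comm _ _
    have h2 : ∀ j, inner ℝ (w j) a = 0 := fun j => by rw [real_inner_comm, haw]
    have h3 : ∀ j, inner ℝ ν (w j) = s j := fun j => rfl
    rw [← hwi i j]
    simp only [inner_sub_left, inner_sub_right, inner_smul_left, inner_smul_right, inner_add_left,
      inner_add_right, haw, h1, h2, h3, hνν, haa, hνa, real_inner_comm ν a, map_div₀, conj_trivial]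
    field_simp
    ring
  · intro i
    simp only [inner_sub_right, inner_smul_right, inner_add_right, hνν, hνa]
    change s i - _ = 0
    field_simp
    ring
  · intro i
    have h1 : ‖a + ν‖ ≤ 2 := by
      calc ‖a + ν‖ ≤ ‖a‖ + ‖ν‖ := norm_add_le _ _
        _ = 2 := by rw [hna, hν]; norm_num
    have : w i - (s i / (1 + k)) • (a + ν) - w i = -((s i / (1 + k)) • (a + ν)) := by abel
    rw [this, norm_neg, norm_smul, Real.norm_eq_abs, abs_div, abs_of_pos (by linarith : 0 < 1 + k)]
    have h2 : |s i| / (1 + k) ≤ |s i| := div_le_self (abs_nonneg _) (by linarith)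
    calc |s i| / (1 + k) * ‖a + ν‖ ≤ |s i| * 2 := by gcongr
      _ = _ := mul_comm _ _

/-- A bilinear form which is nonnegative on the frames contained in `ker ℓ` is bounded below on
every frame in terms of the values of `ℓ`. -/
theorem sum_apply_ge_of_nonneg_on_ker [CompleteSpace E] {B : E →L[ℝ] E →L[ℝ] ℝ}
    {ℓ : E →L[ℝ] ℝ} (hℓ : ℓ ≠ 0) {M : ℝ} (hM : ‖B‖ ≤ M)
    (hB : ∀ w : ι → E, Orthonormal ℝ w → (∀ i, ℓ (w i) = 0) → 0 ≤ ∑ i, B (w i) (w i))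
    {w : ι → E} (hw : Orthonormal ℝ w) :
    -((Fintype.card ι + 4) * M / ‖ℓ‖ * ∑ i, |ℓ (w i)|) ≤ ∑ i, B (w i) (w i) := by
  have hM0 : 0 ≤ M := (norm_nonneg B).trans hM
  have hℓ0 : 0 < ‖ℓ‖ := norm_pos_iff.2 hℓ
  set g : E := (InnerProductSpace.toDual ℝ E).symm ℓ with hg
  have hgn : ‖g‖ = ‖ℓ‖ := by simp [hg]
  have hgi : ∀ v, inner ℝ g v = ℓ v := fun v => by simp [hg]
  set ν : E := ‖ℓ‖⁻¹ • g with hν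
  have hνn : ‖ν‖ = 1 := by
    rw [hν, norm_smul, hgn, norm_inv, norm_norm, inv_mul_cancel₀ hℓ0.ne']
  have hνi : ∀ v, inner ℝ ν v = ‖ℓ‖⁻¹ * ℓ v := fun v => by
    rw [hν, inner_smul_left, hgi]; simp
  have hBle : ∀ v v' : E, |B v v'| ≤ M * ‖v‖ * ‖v'‖ := fun v v' =>
    (B.le_opNorm₂ v v').trans (by gcongr)
  have habs : ∀ v, |inner ℝ ν v| = ‖ℓ‖⁻¹ * |ℓ v| := fun v => by
    rw [hνi, abs_mul, abs_of_pos (inv_pos.2 hℓ0)]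
  have hsum : (Fintype.card ι + 4) * M / ‖ℓ‖ * ∑ i, |ℓ (w i)|
      = (Fintype.card ι + 4) * M * ∑ i, |inner ℝ ν (w i)| := by
    simp only [habs, ← Finset.mul_sum]; field_simp
  rw [hsum]
  have hS0 : 0 ≤ ∑ i, |inner ℝ ν (w i)| := Finset.sum_nonneg fun i _ => abs_nonneg _
  -- A frame that cannot be tilted has `∑ |⟨ν, w i⟩| ≥ 1`, and the trivial bound `-card ι * M` is
  -- enough. Tilting costs `4 * M * |⟨ν, w i⟩|` per vector; hence the constant `card ι + 4`.
  rcases lt_or_ge (∑ i, (inner ℝ ν (w i)) ^ 2) 1 with hs | hs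
  · obtain ⟨w', hw', hker, hnear⟩ := exists_orthonormal_perp_near hw hνn hs
    have h0 := hB w' hw' (fun i => by
      have := hker i
      rw [hνi] at this
      exact (mul_eq_zero.1 this).resolve_left (inv_pos.2 hℓ0).ne')
    have h1 : ∀ i, B (w' i) (w' i) - 4 * M * |inner ℝ ν (w i)| ≤ B (w i) (w i) := fun i => by
      have e : B (w' i) (w' i) - B (w i) (w i) = B (w' i - w i) (w' i) + B (w i) (w' i - w i) := by
        simp only [map_sub, _root_.sub_apply]; ring
      have b1 := (le_abs_self _).trans (hBle (w' i - w i) (w' i))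
      have b2 := (le_abs_self _).trans (hBle (w i) (w' i - w i))
      rw [hw'.1 i] at b1
      rw [hw.1 i] at b2
      have := mul_le_mul_of_nonneg_left (hnear i) hM0
      nlinarith
    have h2 := Finset.sum_le_sum fun i (_ : i ∈ Finset.univ) => h1 i
    rw [Finset.sum_sub_distrib, ← Finset.mul_sum] at h2
    have : 0 ≤ (Fintype.card ι : ℝ) * (M * ∑ i, |inner ℝ ν (w i)|) := by positivity
    nlinarith
  · have h1 : 1 ≤ ∑ i, |inner ℝ ν (w i)| := hs.trans <| Finset.sum_le_sum fun i _ => by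
      have : |inner ℝ ν (w i)| ≤ 1 := by
        simpa [hνn, hw.1 i] using abs_real_inner_le_norm ν (w i)
      rw [← sq_abs]
      nlinarith [abs_nonneg (inner ℝ ν (w i))]
    have h2 : ∀ i, -M ≤ B (w i) (w i) := fun i => by
      have := hBle (w i) (w i)
      rw [hw.1 i, mul_one, mul_one] at this
      exact (abs_le.1 this).1
    have h3 := Finset.sum_le_sum fun i (_ : i ∈ Finset.univ) => h2 i
    simp only [Finset.sum_const, Finset.card_univ, nsmul_eq_mul] at h3
    have h4 : (Fintype.card ι : ℝ) * M ≤ (Fintype.card ι + 4) * M * 1 := by nlinarith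
    have h5 : (Fintype.card ι + 4) * M * 1 ≤
      (Fintype.card ι + 4) * M * ∑ i, |inner ℝ ν (w i)| := by gcongr
    linarith

end Frames

/-- With `PPositive.of_sum_nonneg`, this trades subspaces for orthonormal `p`-frames, which can be
tilted, or kept fixed while the base point moves. -/
theorem PPositive.sum_nonneg {n p : ℕ}
    {B : EuclideanSpace ℝ (Fin n) →L[ℝ] EuclideanSpace ℝ (Fin n) →L[ℝ] ℝ} (hB : PPositive p B)
    {w : Fin p → EuclideanSpace ℝ (Fin n)} (hw : Orthonormal ℝ w) :
    0 ≤ ∑ i, B (w i) (w i) := by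
  set W := Submodule.span ℝ (Set.range w)
  have hmem : ∀ i, w i ∈ W := fun i => Submodule.subset_span ⟨i, rfl⟩
  have horth : Orthonormal ℝ (fun i => (⟨w i, hmem i⟩ : W)) := by
    rw [← W.subtypeₗᵢ.orthonormal_comp_iff]
    exact hw
  have hspan : ⊤ ≤ Submodule.span ℝ (Set.range fun i => (⟨w i, hmem i⟩ : W)) := by
    rw [top_le_iff]
    convert Submodule.span_span_coe_preimage (R := ℝ) (s := Set.range w) using 2
    ext v
    simp [Subtype.ext_iff]
  have hfin : Module.finrank ℝ W = p := by
    simpa using finrank_span_eq_card hw.linearIndependent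
  have := hB W hfin
  rw [traceOn_eq_sum B W (OrthonormalBasis.mk horth hspan)] at this
  simpa using this

theorem PPositive.of_sum_nonneg {n p : ℕ}
    {B : EuclideanSpace ℝ (Fin n) →L[ℝ] EuclideanSpace ℝ (Fin n) →L[ℝ] ℝ}
    (hB : ∀ w : Fin p → EuclideanSpace ℝ (Fin n), Orthonormal ℝ w → 0 ≤ ∑ i, B (w i) (w i)) :
    PPositive p B := by
  intro W hW
  subst hW
  exact hB _ ((stdOrthonormalBasis ℝ W).orthonormal.comp_linearIsometry W.subtypeₗᵢ)

/-! ### Calculus of Hessians -/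

section Hessian

variable {E : Type*} [NormedAddCommGroup E] [NormedSpace ℝ E]

theorem eventually_differentiableAt {f : E → ℝ} {x : E} (hf : ContDiffAt ℝ 2 f x) :
    ∀ᶠ y in 𝓝 x, DifferentiableAt ℝ f y :=
  (hf.eventually (by simp)).mono fun _ hy => hy.differentiableAt (by norm_num)

theorem differentiableAt_fderiv {f : E → ℝ} {x : E} (hf : ContDiffAt ℝ 2 f x) :
    DifferentiableAt ℝ (fderiv ℝ f) x :=
  (hf.fderiv_right (m := 1) (by norm_num)).differentiableAt (by norm_num)

theorem continuous_norm_hessian {f : E → ℝ} (hf : ContDiff ℝ 2 f) :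
    Continuous fun x => ‖fderiv ℝ (fderiv ℝ f) x‖ :=
  ((hf.fderiv_right (m := 1) (by norm_num)).continuous_fderiv (by norm_num)).norm

theorem exists_bound_of_contDiff_of_hasCompactSupport {F : Type*} [NormedAddCommGroup F]
    [NormedSpace ℝ F] {f : E → F} (hf : ContDiff ℝ ∞ f) (hs : HasCompactSupport f) :
    ∃ C, 0 ≤ C ∧ (∀ x, ‖f x‖ ≤ C) ∧ ∀ x y, ‖f x - f y‖ ≤ C * ‖x - y‖ := by
  obtain ⟨L, hL⟩ := hf.lipschitzWith_of_hasCompactSupport hs (by simp)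
  obtain ⟨M, hM⟩ := hs.exists_bound_of_continuous hf.continuous
  exact ⟨max L M, le_max_of_le_left L.2, fun x => (hM x).trans (le_max_right _ _), fun x y =>
    (hL.norm_sub_le x y).trans (by gcongr; exact le_max_left _ _)⟩

theorem exists_bound_fderiv_of_hasCompactSupport {f : E → ℝ} (hf : ContDiff ℝ ∞ f)
    (hs : HasCompactSupport f) :
    ∃ C, 0 ≤ C ∧ ∀ x y w, |fderiv ℝ f x w - fderiv ℝ f y w| ≤ C * ‖x - y‖ * ‖w‖ := by
  obtain ⟨C, hC0, -, hC⟩ := exists_bound_of_contDiff_of_hasCompactSupport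
    (hf.fderiv_right (m := ∞) (by norm_cast)) (hs.fderiv ℝ)
  refine ⟨C, hC0, fun x y w => ?_⟩
  have h := (fderiv ℝ f x - fderiv ℝ f y).le_opNorm w
  exact h.trans (by gcongr; exact hC x y)

theorem exists_bound_hessian_of_hasCompactSupport {f : E → ℝ} (hf : ContDiff ℝ ∞ f)
    (hs : HasCompactSupport f) :
    ∃ C, 0 ≤ C ∧ (∀ x, ‖fderiv ℝ (fderiv ℝ f) x‖ ≤ C) ∧
      ∀ x y w, |fderiv ℝ (fderiv ℝ f) x w w - fderiv ℝ (fderiv ℝ f) y w w|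
        ≤ C * ‖x - y‖ * ‖w‖ * ‖w‖ := by
  have hd : ContDiff ℝ ∞ (fderiv ℝ (fderiv ℝ f)) :=
    (hf.fderiv_right (m := ∞) (by norm_cast)).fderiv_right (by norm_cast)
  obtain ⟨C, hC0, hbd, hC⟩ := exists_bound_of_contDiff_of_hasCompactSupport hd
    ((hs.fderiv ℝ).fderiv ℝ)
  refine ⟨C, hC0, hbd, fun x y w => ?_⟩
  have h := (fderiv ℝ (fderiv ℝ f) x - fderiv ℝ (fderiv ℝ f) y).le_opNorm₂ w w
  exact h.trans (by gcongr; exact hC x y)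

theorem hessian_add {f g : E → ℝ} {x : E} (hf : ContDiffAt ℝ 2 f x) (hg : ContDiffAt ℝ 2 g x) :
    fderiv ℝ (fderiv ℝ (fun y => f y + g y)) x
      = fderiv ℝ (fderiv ℝ f) x + fderiv ℝ (fderiv ℝ g) x := by
  have h : fderiv ℝ (fun y => f y + g y) =ᶠ[𝓝 x] fun y => fderiv ℝ f y + fderiv ℝ g y := by
    filter_upwards [eventually_differentiableAt hf, eventually_differentiableAt hg] with y h1 h2
    exact fderiv_fun_add h1 h2
  rw [h.fderiv_eq]
  exact fderiv_fun_add (differentiableAt_fderiv hf) (differentiableAt_fderiv hg)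

theorem hessian_mul_apply {f g : E → ℝ} {x : E} (hf : ContDiffAt ℝ 2 f x)
    (hg : ContDiffAt ℝ 2 g x) (w : E) :
    fderiv ℝ (fderiv ℝ (fun y => f y * g y)) x w w
      = f x * fderiv ℝ (fderiv ℝ g) x w w + g x * fderiv ℝ (fderiv ℝ f) x w w
        + 2 * (fderiv ℝ f x w * fderiv ℝ g x w) := by
  have h : fderiv ℝ (fun y => f y * g y) =ᶠ[𝓝 x]
      fun y => f y • fderiv ℝ g y + g y • fderiv ℝ f y := by
    filter_upwards [eventually_differentiableAt hf, eventually_differentiableAt hg] with y h1 h2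
    exact fderiv_fun_mul h1 h2
  have df := hf.differentiableAt (by norm_num)
  have dg := hg.differentiableAt (by norm_num)
  have ddf := differentiableAt_fderiv hf
  have ddg := differentiableAt_fderiv hg
  rw [h.fderiv_eq, fderiv_fun_add (df.fun_smul ddg) (dg.fun_smul ddf), fderiv_fun_smul df ddg,
    fderiv_fun_smul dg ddf]
  simp
  ring

theorem hessian_comp_apply {h : ℝ → ℝ} {f : E → ℝ} {x : E} (hh : ContDiffAt ℝ 2 h (f x))
    (hf : ContDiffAt ℝ 2 f x) (w : E) :
    fderiv ℝ (fderiv ℝ (fun y => h (f y))) x w w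
      = deriv h (f x) * fderiv ℝ (fderiv ℝ f) x w w
        + deriv (deriv h) (f x) * (fderiv ℝ f x w) ^ 2 := by
  have e : fderiv ℝ (fun y => h (f y)) =ᶠ[𝓝 x] fun y => deriv h (f y) • fderiv ℝ f y := by
    filter_upwards [eventually_differentiableAt hf,
      hf.continuousAt.eventually (eventually_differentiableAt hh)] with y h1 h2
    exact (h2.hasDerivAt.comp_hasFDerivAt y h1.hasFDerivAt).fderiv
  have df := hf.differentiableAt (by norm_num)
  have ddf := differentiableAt_fderiv hf
  have ddh : DifferentiableAt ℝ (deriv h) (f x) :=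
    (differentiableAt_fderiv hh).clm_apply (differentiableAt_const (1 : ℝ))
  have dc : DifferentiableAt ℝ (fun y => deriv h (f y)) x := ddh.comp x df
  rw [e.fderiv_eq, fderiv_fun_smul dc ddf,
    show fderiv ℝ (fun y => deriv h (f y)) x = _ from
      (ddh.hasDerivAt.comp_hasFDerivAt x df.hasFDerivAt).fderiv]
  simp
  ring

/-- A positive second derivative along a line would make the point also a local minimum on it, so
`F` would be locally constant there and the second derivative zero. -/
theorem IsLocalMax.hessian_nonpos {F : E → ℝ} {x : E} (hmax : IsLocalMax F x)
    (hF : ContDiffAt ℝ 2 F x) (w : E) : fderiv ℝ (fderiv ℝ F) x w w ≤ 0 := by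
  by_contra! hpos
  set γ : ℝ → E := fun t => x + t • w with hγ
  have hγ0 : γ 0 = x := by simp [hγ]
  have hγd : ∀ t, HasDerivAt γ w t := fun t => by
    simpa [hγ] using ((hasDerivAt_id t).smul_const w).const_add x
  have hγc : Filter.Tendsto γ (𝓝 0) (𝓝 x) := by
    have := (hγd 0).continuousAt.tendsto
    rwa [hγ0] at this
  have e : deriv (fun t => F (γ t)) =ᶠ[𝓝 0] fun t => fderiv ℝ F (γ t) w := by
    filter_upwards [hγc.eventually (eventually_differentiableAt hF)] with t ht
    exact (ht.hasFDerivAt.comp_hasDerivAt t (hγd t)).deriv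
  have hd2 : HasDerivAt (fun t => fderiv ℝ F (γ t) w) (fderiv ℝ (fderiv ℝ F) x w w) 0 := by
    have h1 : HasFDerivAt (fderiv ℝ F) (fderiv ℝ (fderiv ℝ F) x) (γ 0) := by
      rw [hγ0]; exact (differentiableAt_fderiv hF).hasFDerivAt
    have h2 := h1.comp_hasDerivAt (0 : ℝ) (hγd 0)
    exact h2.clm_apply (hasDerivAt_const 0 w) |>.congr_deriv (by simp)
  have hdd : deriv (deriv fun t => F (γ t)) 0 = fderiv ℝ (fderiv ℝ F) x w w := by
    rw [e.deriv_eq, hd2.deriv]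
  have hmax' : IsLocalMax (fun t => F (γ t)) 0 := by
    have := hγc.eventually hmax
    simpa only [IsLocalMax, IsMaxFilter, hγ0] using this
  have hmin : IsLocalMin (fun t => F (γ t)) 0 := by
    refine isLocalMin_of_deriv_deriv_pos (by rw [hdd]; exact hpos) hmax'.deriv_eq_zero ?_
    have : ContinuousAt F (γ 0) := by rw [hγ0]; exact hF.continuousAt
    exact this.comp (hγd 0).continuousAt
  have hc : (fun t => F (γ t)) =ᶠ[𝓝 0] fun _ => F (γ 0) := by
    filter_upwards [hmax', hmin] with t h1 h2 using le_antisymm h1 h2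
  have : deriv (deriv fun t => F (γ t)) 0 = 0 := by
    rw [hc.deriv.deriv_eq]; simp
  rw [hdd] at this
  exact hpos.ne' this

end Hessian

section NormSq

variable {E : Type*} [NormedAddCommGroup E] [InnerProductSpace ℝ E]

theorem fderiv_const_mul_norm_sub_sq (κ : ℝ) (x₀ : E) :
    fderiv ℝ (fun y => κ * ‖y - x₀‖ ^ 2) = fun x => (2 * κ) • innerSL ℝ (x - x₀) := by
  funext x
  have h1 : HasFDerivAt (fun y : E => y - x₀) (ContinuousLinearMap.id ℝ E) x :=
    (hasFDerivAt_id x).sub_const x₀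
  have := (h1.norm_sq).const_mul κ
  rw [this.fderiv]
  ext w
  simp
  ring

theorem hessian_const_mul_norm_sub_sq (κ : ℝ) (x₀ x w : E) :
    fderiv ℝ (fderiv ℝ (fun y => κ * ‖y - x₀‖ ^ 2)) x w w = 2 * κ * ‖w‖ ^ 2 := by
  rw [fderiv_const_mul_norm_sub_sq]
  have h1 : HasFDerivAt (fun y : E => y - x₀) (ContinuousLinearMap.id ℝ E) x :=
    (hasFDerivAt_id x).sub_const x₀
  have := (((innerSL ℝ (E := E)).hasFDerivAt (x := x - x₀)).comp x h1).const_smul (2 * κ)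
  have e : fderiv ℝ (fun x => (2 * κ) • innerSL ℝ (x - x₀)) x = _ := this.fderiv
  rw [e]
  change 2 * κ * inner ℝ w w = _
  rw [real_inner_self_eq_norm_sq]

end NormSq

theorem eventually_neg_of_fderiv_neg {E : Type*} [NormedAddCommGroup E] [NormedSpace ℝ E]
    {f : E → ℝ} {x v : E} (hf : DifferentiableAt ℝ f x) (hx : f x = 0) (hv : fderiv ℝ f x v < 0) :
    ∀ᶠ t in 𝓝[>] (0 : ℝ), f (x + t • v) < 0 := by
  have h1 : HasDerivAt (fun t : ℝ => x + t • v) v 0 := by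
    simpa using ((hasDerivAt_id (0 : ℝ)).smul_const v).const_add x
  have h2 : HasDerivAt (fun t : ℝ => f (x + t • v)) (fderiv ℝ f x v) 0 := by
    refine HasFDerivAt.comp_hasDerivAt (0 : ℝ) ?_ h1
    simpa using hf.hasFDerivAt
  have h3 := (hasDerivAt_iff_tendsto_slope.1 h2).mono_left
    (nhdsWithin_mono (0 : ℝ) (fun t (ht : 0 < t) => ht.ne') : 𝓝[>] (0 : ℝ) ≤ 𝓝[≠] 0)
  filter_upwards [h3.eventually (gt_mem_nhds hv), self_mem_nhdsWithin] with t ht ht0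
  rw [slope_def_field] at ht
  simp only [zero_smul, add_zero, hx, sub_zero] at ht
  exact (div_neg_iff.1 ht).resolve_left (fun h => (lt_asymm h.2 ht0)) |>.1

/-! ### The convex cutoff `t * exp(-1/t)` -/

section ConvexCutoff

/-- A smooth convex nondecreasing function vanishing exactly on `(-∞, 0]`. -/
def convexCutoff (t : ℝ) : ℝ := t * expNegInvGlue t

theorem contDiff_convexCutoff : ContDiff ℝ ∞ convexCutoff :=
  contDiff_id.mul expNegInvGlue.contDiff

/-- No case distinction is needed: for `t ≤ 0` the glue function vanishes, and `0⁻¹ = 0`. -/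
theorem deriv_convexCutoff :
    deriv convexCutoff = fun t => (1 + t⁻¹) * expNegInvGlue t := by
  funext t
  have h := expNegInvGlue.hasDerivAt_polynomial_eval_inv_mul 1 t
  simp only [Polynomial.eval_one, one_mul] at h
  refine ((hasDerivAt_id t).mul h).deriv.trans ?_
  rcases eq_or_ne t 0 with rfl | ht
  · simp
  · simp
    field_simp

theorem deriv_deriv_convexCutoff :
    deriv (deriv convexCutoff) = fun t => t⁻¹ ^ 3 * expNegInvGlue t := by
  funext t
  have h := expNegInvGlue.hasDerivAt_polynomial_eval_inv_mul (1 + Polynomial.X) t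
  rw [deriv_convexCutoff]
  simp only [Polynomial.eval_add, Polynomial.eval_one, Polynomial.eval_X] at h
  rw [h.deriv]
  simp
  ring_nf
  simp

theorem deriv_convexCutoff_nonneg (t : ℝ) : 0 ≤ deriv convexCutoff t := by
  rw [deriv_convexCutoff]
  rcases le_or_gt t 0 with ht | ht
  · simp [expNegInvGlue.zero_of_nonpos ht]
  · have := expNegInvGlue.nonneg t
    positivity

theorem deriv_deriv_convexCutoff_nonneg (t : ℝ) : 0 ≤ deriv (deriv convexCutoff) t := by
  rw [deriv_deriv_convexCutoff]
  rcases le_or_gt t 0 with ht | ht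
  · simp [expNegInvGlue.zero_of_nonpos ht]
  · have := expNegInvGlue.nonneg t
    positivity

theorem deriv_convexCutoff_of_nonpos {t : ℝ} (ht : t ≤ 0) : deriv convexCutoff t = 0 := by
  simp [deriv_convexCutoff, expNegInvGlue.zero_of_nonpos ht]

theorem tendsto_convexCutoff_atTop : Filter.Tendsto convexCutoff Filter.atTop Filter.atTop := by
  refine Filter.tendsto_atTop_mono' _ ?_
    (Filter.tendsto_atTop_add_const_right _ (-1) Filter.tendsto_id)
  filter_upwards [Filter.eventually_gt_atTop 0] with t ht
  have h1 : expNegInvGlue t = Real.exp (-t⁻¹) := by simp [expNegInvGlue, ht.not_ge]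
  have h2 := Real.add_one_le_exp (-t⁻¹)
  have h3 : t * (-t⁻¹ + 1) = t + -1 := by field_simp; ring
  rw [convexCutoff, h1, id, ← h3]
  gcongr

end ConvexCutoff

/-- A global smooth compactly supported defining function of an open set. -/
structure IsDefiningFunction {E : Type*} [NormedAddCommGroup E] [NormedSpace ℝ E]
    (Ω : Set E) (ρ : E → ℝ) : Prop where
  contDiff : ContDiff ℝ ∞ ρ
  hasCompactSupport : HasCompactSupport ρ
  mem_iff : ∀ x, x ∈ Ω ↔ ρ x < 0
  fderiv_ne_zero : ∀ x ∈ frontier Ω, fderiv ℝ ρ x ≠ 0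

theorem IsDefiningFunction.eq_zero {E : Type*} [NormedAddCommGroup E] [NormedSpace ℝ E]
    {Ω : Set E} {ρ : E → ℝ} (h : IsDefiningFunction Ω ρ) (hΩ : IsOpen Ω) {x : E}
    (hx : x ∈ frontier Ω) : ρ x = 0 := by
  rw [hΩ.frontier_eq] at hx
  refine le_antisymm ?_ (not_lt.1 fun hlt => hx.2 ((h.mem_iff x).2 hlt))
  exact closure_minimal (fun y hy => ((h.mem_iff y).1 hy).le)
    (isClosed_le h.contDiff.continuous continuous_const) hx.1

/-! ### From local `p`-convexity to the boundary condition -/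

section BoundaryConvexity

variable {n p : ℕ}

/-- Maximum principle: a function `r` whose level sets have negative mean curvature in some
`p`-dimensional tangential direction forces `{r < 0}` into the hull of the lateral boundary. -/
theorem mem_pHull_of_barrier {X : Set (EuclideanSpace ℝ (Fin n))} (hX : IsOpen X)
    {r : EuclideanSpace ℝ (Fin n) → ℝ}
    (hr : ContDiff ℝ 2 r) {x₀ : EuclideanSpace ℝ (Fin n)} {δ : ℝ}
    (hsub : ∀ x ∈ Metric.closedBall x₀ δ, r x < 0 → x ∈ X)
    (hbar : ∀ x ∈ Metric.ball x₀ δ, ∃ w : Fin p → EuclideanSpace ℝ (Fin n), Orthonormal ℝ w ∧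
      (∀ i, fderiv ℝ r x (w i) = 0) ∧ ∑ i, fderiv ℝ (fderiv ℝ r) x (w i) (w i) < 0)
    {x₁ : EuclideanSpace ℝ (Fin n)} (hx₁ : x₁ ∈ Metric.ball x₀ δ) (hrx₁ : r x₁ < 0)
    (hK : Metric.sphere x₀ δ ∩ {x | r x ≤ 0} ⊆ X) :
    x₁ ∈ pHull p X (Metric.sphere x₀ δ ∩ {x | r x ≤ 0}) := by
  refine ⟨hsub _ (Metric.ball_subset_closedBall hx₁) hrx₁, fun u hu => ?_⟩
  by_contra! hlt
  set K := Metric.sphere x₀ δ ∩ {x | r x ≤ 0} with hKdef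
  have hKc : IsCompact K := (isCompact_sphere x₀ δ).inter_right
    (isClosed_le hr.continuous continuous_const)
  have hKu : ∀ y ∈ K, u y < u x₁ := fun y hy => by
    have h : (u y : EReal) ≤ ⨆ y ∈ K, (u y : EReal) := le_iSup₂ (f := fun y _ => (u y : EReal)) y hy
    exact_mod_cast h.trans_lt hlt
  obtain ⟨m, hm, hmu⟩ : ∃ m, (∀ y ∈ K, u y ≤ m) ∧ m < u x₁ := by
    rcases K.eq_empty_or_nonempty with hKe | hKn
    · exact ⟨u x₁ - 1, by simp [hKe], by linarith⟩
    · obtain ⟨y, hy, hmax⟩ := hKc.exists_isMaxOn hKn (hu.1.continuousOn.mono hK)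
      exact ⟨u y, fun z hz => hmax hz, hKu y hy⟩
  -- Points with `r = 0` need not lie in `X`; the level `-ε` gives a compact subset of `X` still
  -- containing `x₁`.
  set ε := -r x₁ / 2 with hε
  have hεpos : 0 < ε := by linarith
  set D := Metric.closedBall x₀ δ ∩ {x | r x ≤ -ε} with hD
  have hDc : IsCompact D := (isCompact_closedBall x₀ δ).inter_right
    (isClosed_le hr.continuous continuous_const)
  have hDX : D ⊆ X := fun x hx => hsub x hx.1 (by have := hx.2; simp at this; linarith)
  have hx₁D : x₁ ∈ D := ⟨Metric.ball_subset_closedBall hx₁, by simp; linarith⟩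
  -- On `D`, `G` is zero where `r = -ε` and nonpositive on the sphere, so its positive maximum is
  -- interior. There, along a frame in `ker dr`, the cross terms of the Hessian vanish and the two
  -- remaining traces have a positive sum.
  set G : EuclideanSpace ℝ (Fin n) → ℝ := fun x => (u x - m) * (-ε - r x) with hG
  have hGc : ContinuousOn G D := ((hu.1.continuousOn.mono hDX).sub continuousOn_const).mul
    (continuousOn_const.sub hr.continuous.continuousOn)
  obtain ⟨x₂, hx₂, hmax⟩ := hDc.exists_isMaxOn ⟨x₁, hx₁D⟩ hGc
  have hGpos : 0 < G x₂ := lt_of_lt_of_le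
    (mul_pos (by linarith) (by linarith)) (hmax hx₁D)
  have hrx₂ : r x₂ ≤ -ε := hx₂.2
  have hg0 : 0 < -ε - r x₂ := by
    rcases hrx₂.lt_or_eq with h | h
    · linarith
    · simp [hG, h] at hGpos
  have hf0 : 0 < u x₂ - m := pos_of_mul_pos_left hGpos hg0.le
  have hball : x₂ ∈ Metric.ball x₀ δ := by
    rcases (Metric.mem_closedBall.1 hx₂.1).lt_or_eq with h | h
    · exact h
    · have := hm x₂ ⟨h, by simp; linarith⟩
      linarith
  have hloc : IsLocalMax G x₂ := by
    have hN : Metric.ball x₀ δ ∩ {x | r x < -ε} ∈ 𝓝 x₂ :=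
      (Metric.isOpen_ball.inter (isOpen_lt hr.continuous continuous_const)).mem_nhds
        ⟨hball, by simp; linarith⟩
    filter_upwards [hN] with y hy
    exact hmax ⟨Metric.ball_subset_closedBall hy.1, (show r y < -ε from hy.2).le⟩
  have hu2 : ContDiffAt ℝ 2 u x₂ := (hu.1.contDiffAt (hX.mem_nhds (hDX hx₂))).of_le (by norm_cast)
  have hf2 : ContDiffAt ℝ 2 (fun x => u x - m) x₂ := hu2.sub contDiffAt_const
  have hg2 : ContDiffAt ℝ 2 (fun x => -ε - r x) x₂ := contDiffAt_const.sub hr.contDiffAt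
  obtain ⟨w, hw, hker, hneg⟩ := hbar x₂ hball
  have h0 : ∑ i, fderiv ℝ (fderiv ℝ G) x₂ (w i) (w i) ≤ 0 :=
    Finset.sum_nonpos fun i _ => IsLocalMax.hessian_nonpos hloc (hf2.mul hg2) (w i)
  have e1 : fderiv ℝ (fun x => u x - m) = fderiv ℝ u := by
    funext x; exact fderiv_sub_const _
  have e2 : fderiv ℝ (fun x => -ε - r x) = fun x => -fderiv ℝ r x := by
    funext x; exact fderiv_const_sub _
  have e3 : fderiv ℝ (fun x => -fderiv ℝ r x) x₂ = -fderiv ℝ (fderiv ℝ r) x₂ := fderiv_fun_neg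
  simp only [hG, hessian_mul_apply hf2 hg2, e1, e2, e3, neg_apply, hker, neg_zero, mul_zero,
    add_zero, Finset.sum_add_distrib, mul_neg, Finset.sum_neg_distrib, ← Finset.mul_sum] at h0
  have h1 := (hu.2 x₂ (hDX hx₂)).sum_nonneg hw
  nlinarith [mul_nonneg hg0.le h1, mul_pos_of_neg_of_neg (neg_neg_of_pos hf0) hneg]

/-- If `Ω ∩ U` is `p`-convex, the boundary of `Ω` is `p`-convex at each of its points in `U`. -/
theorem IsDefiningFunction.sum_hessian_nonneg {Ω U : Set (EuclideanSpace ℝ (Fin n))}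
    {ρ : EuclideanSpace ℝ (Fin n) → ℝ}
    (hΩ : IsOpen Ω) (hρ : IsDefiningFunction Ω ρ) (hU : IsOpen U) (hconv : PConvex p (Ω ∩ U))
    {x₀ : EuclideanSpace ℝ (Fin n)} (hx₀ : x₀ ∈ frontier Ω) (hx₀U : x₀ ∈ U)
    {w : Fin p → EuclideanSpace ℝ (Fin n)} (hw : Orthonormal ℝ w)
    (hker : ∀ i, fderiv ℝ ρ x₀ (w i) = 0) :
    0 ≤ ∑ i, fderiv ℝ (fderiv ℝ ρ) x₀ (w i) (w i) := by
  by_contra! hneg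
  set S := ∑ i, fderiv ℝ (fderiv ℝ ρ) x₀ (w i) (w i) with hS
  -- The quadratic term raises the trace by `2 * p * κ < -S / 2`, so it stays negative.
  set κ : ℝ := -S / (4 * (p + 1)) with hκ
  have hκpos : 0 < κ := div_pos (by linarith) (by positivity)
  set N : EuclideanSpace ℝ (Fin n) → ℝ := fun x => κ * ‖x - x₀‖ ^ 2 with hN
  have hNc : ContDiff ℝ 2 N := contDiff_const.mul ((contDiff_id.sub contDiff_const).norm_sq ℝ)
  have hρ2 : ContDiff ℝ 2 ρ := hρ.contDiff.of_le (by norm_cast)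
  set r : EuclideanSpace ℝ (Fin n) → ℝ := fun x => ρ x + N x with hr
  have hr2 : ContDiff ℝ 2 r := hρ2.add hNc
  have hρ0 : ρ x₀ = 0 := hρ.eq_zero hΩ hx₀
  have hr0 : r x₀ = 0 := by simp [hr, hN, hρ0]
  have hdr0 : fderiv ℝ r x₀ = fderiv ℝ ρ x₀ := by
    rw [hr, fderiv_fun_add (hρ2.differentiable (by norm_num) x₀)
      (hNc.differentiable (by norm_num) x₀), hN, fderiv_const_mul_norm_sub_sq]
    simp
  have hdne : fderiv ℝ r x₀ ≠ 0 := hdr0 ▸ hρ.fderiv_ne_zero x₀ hx₀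
  have hHr : ∑ i, fderiv ℝ (fderiv ℝ r) x₀ (w i) (w i) < 0 := by
    have : ∀ i, fderiv ℝ (fderiv ℝ r) x₀ (w i) (w i)
        = fderiv ℝ (fderiv ℝ ρ) x₀ (w i) (w i) + 2 * κ := fun i => by
      rw [hr, hessian_add hρ2.contDiffAt hNc.contDiffAt, add_apply, add_apply, hN,
        hessian_const_mul_norm_sub_sq, hw.1 i]
      norm_num
    simp only [this, Finset.sum_add_distrib, ← hS, Finset.sum_const, Finset.card_univ,
      Fintype.card_fin, nsmul_eq_mul]
    have h4 : κ * (4 * (p + 1)) = -S := by rw [hκ]; field_simp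
    nlinarith
  have hdc : Continuous (fderiv ℝ r) := hr2.continuous_fderiv (by norm_num)
  have hddc : Continuous (fderiv ℝ (fderiv ℝ r)) :=
    (hr2.fderiv_right (m := 1) (by norm_num)).continuous_fderiv (by norm_num)
  -- By `sum_apply_ge_of_nonneg_on_ker`, `φ x < 0` forces some frame in `ker dr` at `x` to have
  -- negative trace. Here `w` is fixed, so this is an open condition near `x₀`.
  set φ : EuclideanSpace ℝ (Fin n) → ℝ := fun x => ∑ i, fderiv ℝ (fderiv ℝ r) x (w i) (w i)
    + (Fintype.card (Fin p) + 4) * ‖fderiv ℝ (fderiv ℝ r) x‖ / ‖fderiv ℝ r x‖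
      * ∑ i, |fderiv ℝ r x (w i)| with hφ
  have hφc : ContinuousAt φ x₀ := by
    have h1 : ContinuousAt (fun x => ‖fderiv ℝ r x‖) x₀ := hdc.norm.continuousAt
    have h2 : ContinuousAt (fun x => (Fintype.card (Fin p) + 4) * ‖fderiv ℝ (fderiv ℝ r) x‖) x₀ :=
      (continuous_const.mul (continuous_norm_hessian hr2)).continuousAt
    have h3 : ContinuousAt (fun x => ∑ i, fderiv ℝ (fderiv ℝ r) x (w i) (w i)) x₀ := by
      fun_prop
    have h4 : ContinuousAt (fun x => ∑ i, |fderiv ℝ r x (w i)|) x₀ := by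
      fun_prop
    exact h3.add ((h2.div h1 (norm_ne_zero_iff.2 hdne)).mul h4)
  have hφ0 : φ x₀ < 0 := by simpa [hφ, hdr0, hker] using hHr
  have hbar : ∀ᶠ x in 𝓝 x₀, ∃ w : Fin p → EuclideanSpace ℝ (Fin n), Orthonormal ℝ w ∧
      (∀ i, fderiv ℝ r x (w i) = 0) ∧ ∑ i, fderiv ℝ (fderiv ℝ r) x (w i) (w i) < 0 := by
    filter_upwards [hφc.eventually (gt_mem_nhds hφ0), hdc.continuousAt.eventually_ne hdne]
      with x h1 h2
    by_contra! hcon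
    have := sum_apply_ge_of_nonneg_on_ker h2 le_rfl hcon hw
    simp only [hφ] at h1
    linarith
  obtain ⟨δ, hδ, hball⟩ := Metric.nhds_basis_closedBall.mem_iff.1
    (Filter.inter_mem hbar (hU.mem_nhds hx₀U))
  have hlt : ∀ x, r x < 0 → ρ x < 0 := fun x hx => by
    have : 0 ≤ N x := by positivity
    simp only [hr] at hx; linarith
  set K := Metric.sphere x₀ δ ∩ {x | r x ≤ 0} with hK
  -- On the sphere `r ≤ 0` means `ρ ≤ -κ δ²`: the quadratic term keeps `K` off the boundary.
  have hKsub : K ⊆ Ω ∩ U := fun x hx => by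
    refine ⟨(hρ.mem_iff x).2 ?_, (hball (Metric.sphere_subset_closedBall hx.1)).2⟩
    have h1 : ‖x - x₀‖ = δ := mem_sphere_iff_norm.1 hx.1
    have h2 : ρ x + κ * ‖x - x₀‖ ^ 2 ≤ 0 := hx.2
    rw [h1] at h2
    have : 0 < κ * δ ^ 2 := by positivity
    linarith
  have hKc : IsCompact K := (isCompact_sphere x₀ δ).inter_right
    (isClosed_le hr2.continuous continuous_const)
  have hclosed := (hconv K hKsub hKc).isClosed
  obtain ⟨v, hv⟩ : ∃ v, fderiv ℝ r x₀ v < 0 := by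
    by_contra! hcon
    refine hdne (ContinuousLinearMap.ext fun v => ?_)
    have := hcon (-v)
    rw [map_neg] at this
    exact le_antisymm (by simpa using this) (hcon v)
  have hline : Filter.Tendsto (fun t : ℝ => x₀ + t • v) (𝓝[>] 0) (𝓝 x₀) := by
    have : Continuous (fun t : ℝ => x₀ + t • v) := by fun_prop
    have := this.tendsto 0
    simp only [zero_smul, add_zero] at this
    exact this.mono_left nhdsWithin_le_nhds
  have hmem : x₀ ∈ pHull p (Ω ∩ U) K := by
    refine hclosed.mem_of_tendsto hline ?_
    filter_upwards [eventually_neg_of_fderiv_neg (hr2.differentiable (by norm_num) x₀) hr0 hv,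
      hline.eventually (Metric.ball_mem_nhds x₀ hδ)] with t h1 h2
    exact mem_pHull_of_barrier (hΩ.inter hU) hr2
      (fun x hx hrx => ⟨(hρ.mem_iff x).2 (hlt x hrx), (hball hx).2⟩)
      (fun x hx => (hball (Metric.ball_subset_closedBall hx)).1) h2 h1 hKsub
  exact (hΩ.frontier_eq ▸ hx₀).2 hmem.1.1

end BoundaryConvexity

theorem fderiv_nonpos_of_nonpos_on {E : Type*} [NormedAddCommGroup E] [NormedSpace ℝ E]
    {Ω : Set E} {g : E → ℝ} {x v : E} (hg : DifferentiableAt ℝ g x)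
    (hx : g x = 0) (hneg : ∀ y ∈ Ω, g y ≤ 0) (hev : ∀ᶠ t in 𝓝[>] (0 : ℝ), x + t • v ∈ Ω) :
    fderiv ℝ g x v ≤ 0 := by
  by_contra! hpos
  have h := eventually_neg_of_fderiv_neg (f := fun y => -g y) (v := v) hg.fun_neg (by simp [hx])
    (by rw [fderiv_fun_neg]; simpa using hpos)
  obtain ⟨t, ht1, ht2⟩ := (h.and hev).exists
  linarith [hneg _ ht2]

/-! ### Construction of a global defining function -/

section Construction

variable {E : Type*} [NormedAddCommGroup E] [InnerProductSpace ℝ E] [FiniteDimensional ℝ E]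

theorem contDiff_bump_mul {x : E} (f : ContDiffBump x) {B : Set E} (hB : IsOpen B) {ρ : E → ℝ}
    (hρ : ContDiffOn ℝ ∞ ρ B) (hsub : Metric.closedBall x f.rOut ⊆ B) :
    ContDiff ℝ ∞ (fun y => f y * ρ y) := by
  rw [contDiff_iff_contDiffAt]
  intro y
  by_cases hy : y ∈ tsupport f
  · rw [f.tsupport_eq] at hy
    exact f.contDiffAt.mul (hρ.contDiffAt (hB.mem_nhds (hsub hy)))
  · refine (contDiffAt_const (c := (0 : ℝ))).congr_of_eventuallyEq ?_
    filter_upwards [notMem_tsupport_iff_eventuallyEq.1 hy] with z hz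
    simp [hz]

/-- The germ at a point of `closure Ω` of a defining function, with the global sign condition. -/
def IsLocalDefiningFunction (Ω : Set E) (x : E) (g : E → ℝ) : Prop :=
  ContDiff ℝ ∞ g ∧ HasCompactSupport g ∧ (∀ y ∈ Ω, g y ≤ 0) ∧ (∀ y, y ∉ Ω → 0 ≤ g y) ∧
    ∀ᶠ y in 𝓝 x, (y ∈ Ω → g y < 0) ∧ (y ∈ frontier Ω → fderiv ℝ g y ≠ 0)

theorem exists_isLocalDefiningFunction_of_mem {Ω : Set E} (hΩ : IsOpen Ω) {x : E} (hx : x ∈ Ω) :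
    ∃ g, IsLocalDefiningFunction Ω x g := by
  obtain ⟨ε, hε, hsub⟩ := Metric.nhds_basis_closedBall.mem_iff.1 (hΩ.mem_nhds hx)
  let f : ContDiffBump x := ⟨ε / 2, ε, by positivity, by linarith⟩
  refine ⟨fun y => -f y, f.contDiff.neg, f.hasCompactSupport.neg, fun y _ => by
    simpa using f.nonneg, fun y hy => ?_, ?_⟩
  · have : f y = 0 := f.zero_of_le_dist <| by
      by_contra! h
      exact hy (hsub h.le)
    simp [this]
  · filter_upwards [Metric.ball_mem_nhds x f.rOut_pos, hΩ.mem_nhds hx] with y hy hyΩ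
    refine ⟨fun _ => by simpa using f.pos_of_mem_ball hy, fun hfr => ?_⟩
    exact absurd hyΩ (hΩ.frontier_eq ▸ hfr).2

theorem exists_isLocalDefiningFunction_of_mem_frontier {Ω B : Set E} {ρ : E → ℝ} {x : E}
    (hB : IsOpen B) (hxB : x ∈ B) (hρ : ContDiffOn ℝ ∞ ρ B)
    (hΩB : Ω ∩ B = {y | y ∈ B ∧ ρ y < 0})
    (hd : ∀ y ∈ frontier Ω ∩ B, fderiv ℝ ρ y ≠ 0) :
    ∃ g, IsLocalDefiningFunction Ω x g := by
  obtain ⟨ε, hε, hsub⟩ := Metric.nhds_basis_closedBall.mem_iff.1 (hB.mem_nhds hxB)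
  let f : ContDiffBump x := ⟨ε / 2, ε, by positivity, by linarith⟩
  have hmem : ∀ y ∈ B, (y ∈ Ω ↔ ρ y < 0) := fun y hy => by
    have := Set.ext_iff.1 hΩB y
    simpa [hy] using this
  have hout : ∀ y, y ∉ B → f y = 0 := fun y hy => f.zero_of_le_dist <| by
    by_contra! h
    exact hy (hsub h.le)
  refine ⟨fun y => f y * ρ y, contDiff_bump_mul f hB hρ hsub, f.hasCompactSupport.mul_right,
    fun y hy => ?_, fun y hy => ?_, ?_⟩
  · by_cases hyB : y ∈ B
    · exact mul_nonpos_of_nonneg_of_nonpos f.nonneg ((hmem y hyB).1 hy).le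
    · simp [hout y hyB]
  · by_cases hyB : y ∈ B
    · exact mul_nonneg f.nonneg (not_lt.1 fun h => hy ((hmem y hyB).2 h))
    · simp [hout y hyB]
  · filter_upwards [Metric.ball_mem_nhds x f.rIn_pos] with y hy
    have h1 : f y = 1 := f.one_of_mem_closedBall (Metric.ball_subset_closedBall hy)
    have hyB : y ∈ B := hsub <| Metric.closedBall_subset_closedBall f.rIn_lt_rOut.le
      (Metric.ball_subset_closedBall hy)
    refine ⟨fun hyΩ => by simpa [h1] using (hmem y hyB).1 hyΩ, fun hyf => ?_⟩
    have : (fun z => f z * ρ z) =ᶠ[𝓝 y] ρ := by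
      filter_upwards [f.eventuallyEq_one_of_mem_ball hy] with z hz
      simp [hz]
    rw [this.fderiv_eq]
    exact hd y ⟨hyf, hyB⟩

end Construction

/-- The local functions have the right weak sign everywhere, so a finite sum works without a
partition of unity. -/
theorem exists_isDefiningFunction {E : Type*} [NormedAddCommGroup E] [InnerProductSpace ℝ E]
    {Ω : Set E} (hΩ : IsOpen Ω) (hc : IsCompact (closure Ω))
    (hloc : ∀ x ∈ closure Ω, ∃ g, IsLocalDefiningFunction Ω x g) :
    ∃ ρ, IsDefiningFunction Ω ρ := by
  choose! g hg using hloc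
  obtain ⟨t, ht, hcov⟩ := hc.elim_nhds_subcover _ fun x hx => (hg x hx).2.2.2.2
  have hclosed : ∀ x ∈ t, ∀ y ∈ frontier Ω, g x y = 0 := fun x hx y hy => by
    obtain ⟨h1, -, h3, h4, -⟩ := hg x (ht x hx)
    rw [hΩ.frontier_eq] at hy
    exact le_antisymm (closure_minimal h3 (isClosed_le h1.continuous continuous_const) hy.1)
      (h4 y hy.2)
  have hdiff : ∀ x ∈ t, ∀ y, DifferentiableAt ℝ (g x) y := fun x hx y =>
    (hg x (ht x hx)).1.differentiable (by simp) y
  refine ⟨fun y => ∑ x ∈ t, g x y, ContDiff.sum fun x hx => (hg x (ht x hx)).1, ?_, ?_, ?_⟩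
  · refine HasCompactSupport.intro (K := ⋃ x ∈ t, tsupport (g x))
      (t.isCompact_biUnion fun x hx => (hg x (ht x hx)).2.1) fun y hy => ?_
    refine Finset.sum_eq_zero fun x hx => ?_
    simp only [Set.mem_iUnion, not_exists] at hy
    exact image_eq_zero_of_notMem_tsupport (hy x hx)
  · intro y
    constructor
    · intro hy
      obtain ⟨x, hx, hxy⟩ := Set.mem_iUnion₂.1 (hcov (subset_closure hy))
      exact Finset.sum_neg' (fun z hz => (hg z (ht z hz)).2.2.1 y hy) ⟨x, hx, hxy.1 hy⟩
    · intro hneg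
      by_contra hy
      exact hneg.not_ge (Finset.sum_nonneg fun z hz => (hg z (ht z hz)).2.2.2.1 y hy)
  · intro y hy
    obtain ⟨x, hx, hxy⟩ := Set.mem_iUnion₂.1 (hcov (frontier_subset_closure hy))
    obtain ⟨v, hv⟩ : ∃ v, fderiv ℝ (g x) y v < 0 := by
      by_contra! hcon
      refine hxy.2 hy (ContinuousLinearMap.ext fun v => ?_)
      have := hcon (-v)
      rw [map_neg] at this
      exact le_antisymm (by simpa using this) (hcon v)
    -- Since `v` points into `Ω`, where every summand is nonpositive, all differentials are
    -- nonpositive on `v` and cannot cancel the negative one.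
    have hev : ∀ᶠ s in 𝓝[>] (0 : ℝ), y + s • v ∈ Ω := by
      filter_upwards [eventually_neg_of_fderiv_neg (hdiff x hx y) (hclosed x hx y hy) hv] with s hs
      by_contra hcon
      exact hs.not_ge ((hg x (ht x hx)).2.2.2.1 _ hcon)
    have hsum : ∑ z ∈ t, fderiv ℝ (g z) y v < 0 :=
      Finset.sum_neg' (fun z hz => fderiv_nonpos_of_nonpos_on (hdiff z hz y) (hclosed z hz y hy)
        (hg z (ht z hz)).2.2.1 hev) ⟨x, hx, hv⟩
    intro h0
    rw [fderiv_fun_sum fun z hz => hdiff z hz y] at h0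
    have := DFunLike.congr_fun h0 v
    simp at this
    linarith

theorem HasSmoothBoundary.exists_isDefiningFunction {n : ℕ} {Ω : Set (EuclideanSpace ℝ (Fin n))}
    (h : HasSmoothBoundary Ω) (hΩ : IsOpen Ω) (hc : IsCompact (closure Ω)) :
    ∃ ρ, IsDefiningFunction Ω ρ := by
  refine PGeom.exists_isDefiningFunction hΩ hc fun x hx => ?_
  by_cases hxΩ : x ∈ Ω
  · exact exists_isLocalDefiningFunction_of_mem hΩ hxΩ
  · have hxf : x ∈ frontier Ω := hΩ.frontier_eq ▸ ⟨hx, hxΩ⟩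
    obtain ⟨B, ρ, hB, hxB, hρ, hΩB, -, hd⟩ := h x hxf
    exact exists_isLocalDefiningFunction_of_mem_frontier hB hxB hρ hΩB hd

theorem IsPreconnected.exists_mem_frontier {X : Type*} [TopologicalSpace X] {S Ω : Set X}
    (hS : IsPreconnected S) (hΩ : IsOpen Ω) {x y : X} (hx : x ∈ S) (hy : y ∈ S) (hxΩ : x ∈ Ω)
    (hyΩ : y ∉ Ω) : ∃ z ∈ S, z ∈ frontier Ω := by
  by_contra! hcon
  rw [hΩ.frontier_eq] at hcon
  have hcov : ∀ z ∈ S, z ∉ Ω → z ∈ (closure Ω)ᶜ := fun z hz hzΩ hzc => hcon z hz ⟨hzc, hzΩ⟩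
  obtain ⟨z, -, hz1, hz2⟩ := hS Ω (closure Ω)ᶜ hΩ isClosed_closure.isOpen_compl
    (fun z hz => by
      by_cases h : z ∈ Ω
      · exact Or.inl h
      · exact Or.inr (hcov z hz h)) ⟨x, hx, hxΩ⟩ ⟨y, hy, hcov y hy hyΩ⟩
  exact hz2 (subset_closure hz1)

theorem IsDefiningFunction.exists_lt_norm_fderiv {E : Type*} [NormedAddCommGroup E]
    [NormedSpace ℝ E] {Ω : Set E} {ρ : E → ℝ} (hρ : IsDefiningFunction Ω ρ)
    (hc : IsCompact (frontier Ω)) : ∃ c > 0, ∀ x ∈ frontier Ω, c < ‖fderiv ℝ ρ x‖ := by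
  obtain ⟨c, hc0, hcle⟩ := hc.exists_forall_le' (f := fun x => ‖fderiv ℝ ρ x‖)
    (hρ.contDiff.continuous_fderiv (by simp)).norm.continuousOn (a := 0)
    (fun x hx => norm_pos_iff.2 (hρ.fderiv_ne_zero x hx))
  exact ⟨c / 2, by positivity, fun x hx => by linarith [hcle x hx]⟩

/-! ### Estimates at interior points near the boundary -/

section Distance

variable {E : Type*} [NormedAddCommGroup E] [InnerProductSpace ℝ E] [CompleteSpace E]
  {Ω : Set E} {ρ : E → ℝ}

/-- Near the boundary, the distance to the boundary is controlled by the defining function. -/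
theorem IsDefiningFunction.exists_near_frontier (hρ : IsDefiningFunction Ω ρ) (hΩ : IsOpen Ω)
    (hc : IsCompact (frontier Ω)) :
    ∃ C, 0 ≤ C ∧ ∃ N, IsOpen N ∧ frontier Ω ⊆ N ∧ ∀ x ∈ N, x ∈ Ω →
      ∃ y ∈ frontier Ω, ‖x - y‖ ≤ C * |ρ x| := by
  obtain ⟨c, hc0, hcf⟩ := hρ.exists_lt_norm_fderiv hc
  have hdc : Continuous (fderiv ℝ ρ) := hρ.contDiff.continuous_fderiv (by simp)
  have hd : Differentiable ℝ ρ := hρ.contDiff.differentiable (by simp)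
  obtain ⟨L, hL⟩ := ContDiff.lipschitzWith_of_hasCompactSupport (n := 1)
    (hρ.hasCompactSupport.fderiv (𝕜 := ℝ)) (hρ.contDiff.fderiv_right (by norm_cast)) one_ne_zero
  have hL0 : (0 : ℝ) ≤ L := L.2
  refine ⟨4 / c, by positivity, {x | c < ‖fderiv ℝ ρ x‖ ∧ |ρ x| < c ^ 2 / (8 * (L + 1))},
    (isOpen_lt continuous_const hdc.norm).inter (isOpen_lt hρ.contDiff.continuous.abs
      continuous_const), fun x hx => ⟨hcf x hx, ?_⟩, fun x hx hxΩ => ?_⟩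
  · rw [hρ.eq_zero hΩ hx, abs_zero]; positivity
  obtain ⟨hcx, hsmall⟩ := hx
  set G := ‖fderiv ℝ ρ x‖ with hG
  have hG0 : 0 < G := hc0.trans hcx
  set a := |ρ x| with ha
  have hρx : ρ x < 0 := (hρ.mem_iff x).1 hxΩ
  have ha0 : 0 < a := abs_pos.2 hρx.ne
  have haρ : ρ x = -a := by rw [ha, abs_of_neg hρx]; ring
  set g : E := (InnerProductSpace.toDual ℝ E).symm (fderiv ℝ ρ x) with hg
  have hgn : ‖g‖ = G := by simp [hg, hG]
  have hgv : fderiv ℝ ρ x g = G ^ 2 := by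
    have : ∀ v, inner ℝ g v = fderiv ℝ ρ x v := fun v => by simp [hg]
    rw [← this, real_inner_self_eq_norm_sq, hgn]
  -- Moving by `t • g` along the gradient raises `ρ = -a` by `4a` to first order, with error at most
  -- `L t * 4a ≤ 2a`. So `ρ` becomes positive and the segment, of length `4a / G`, meets the
  -- boundary.
  set t := 4 * a / G ^ 2 with ht
  have ht0 : 0 < t := by positivity
  have htG : t * G ^ 2 = 4 * a := by rw [ht]; field_simp
  have hLt : L * t ≤ 1 / 2 := by
    have h1 : a * (8 * (L + 1)) < c ^ 2 := (lt_div_iff₀ (by positivity)).1 hsmall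
    have h2 : c ^ 2 ≤ G ^ 2 := by gcongr
    have h3 : L * t * G ^ 2 = L * (4 * a) := by rw [mul_assoc, htG]
    by_contra! hcon
    have h4 := mul_lt_mul_of_pos_right hcon (by positivity : 0 < G ^ 2)
    nlinarith
  have htg : ‖t • g‖ = t * G := by rw [norm_smul, hgn, Real.norm_eq_abs, abs_of_pos ht0]
  set z := x + t • g with hz
  have hseg : ∀ y ∈ segment ℝ x z, ‖y - x‖ ≤ t * G := fun y hy => by
    rw [← htg, hz, segment_eq_image'] at *
    obtain ⟨θ, hθ, rfl⟩ := hy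
    simp only [add_sub_cancel_left]
    rw [norm_smul, Real.norm_eq_abs, abs_of_nonneg hθ.1]
    exact mul_le_of_le_one_left (norm_nonneg _) hθ.2
  have hmv := (convex_segment (𝕜 := ℝ) x z).norm_image_sub_le_of_norm_fderiv_le' (𝕜 := ℝ) (f := ρ)
    (φ := fderiv ℝ ρ x) (C := L * (t * G)) (fun y _ => hd y) (fun y hy =>
      (hL.norm_sub_le y x).trans (by gcongr; exact hseg y hy))
    (left_mem_segment ℝ x z) (right_mem_segment ℝ x z)
  have hzx : z - x = t • g := by simp [hz]
  rw [hzx, htg, map_smul, smul_eq_mul, hgv, htG, haρ, Real.norm_eq_abs] at hmv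
  have hpos : 0 < ρ z := by
    have h1 := (abs_le.1 hmv).1
    have h2 : L * (t * G) * (t * G) = L * t * (t * G ^ 2) := by ring
    rw [h2, htG] at h1
    nlinarith
  obtain ⟨y, hyS, hy⟩ := IsPreconnected.exists_mem_frontier
    (convex_segment (𝕜 := ℝ) x z).isPreconnected hΩ (left_mem_segment ℝ x z)
    (right_mem_segment ℝ x z) hxΩ (fun h => lt_asymm hpos ((hρ.mem_iff z).1 h))
  refine ⟨y, hy, ?_⟩
  rw [norm_sub_rev]
  refine (hseg y hyS).trans ?_
  have h1 : t * G = 4 / G * a := by rw [ht]; field_simp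
  rw [h1]
  gcongr

/-- Lower bound for the Hessian of a defining function at interior points near the boundary. -/
theorem IsDefiningFunction.exists_sum_hessian_ge {ι : Type*} [Fintype ι]
    (hρ : IsDefiningFunction Ω ρ) (hΩ : IsOpen Ω) (hc : IsCompact (frontier Ω))
    (hpos : ∀ x ∈ frontier Ω, ∀ w : ι → E, Orthonormal ℝ w → (∀ i, fderiv ℝ ρ x (w i) = 0) →
      0 ≤ ∑ i, fderiv ℝ (fderiv ℝ ρ) x (w i) (w i)) :
    ∃ C, 0 ≤ C ∧ ∃ N, IsOpen N ∧ frontier Ω ⊆ N ∧ ∀ x ∈ N, x ∈ Ω → ∀ w : ι → E, Orthonormal ℝ w →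
      -(C * (|ρ x| + ∑ i, |fderiv ℝ ρ x (w i)|)) ≤ ∑ i, fderiv ℝ (fderiv ℝ ρ) x (w i) (w i) := by
  obtain ⟨c, hc0, hcf⟩ := hρ.exists_lt_norm_fderiv hc
  obtain ⟨C₁, hC₁, N, hN, hfN, hnear⟩ := hρ.exists_near_frontier hΩ hc
  obtain ⟨L₁, hL₁0, hL₁⟩ := exists_bound_fderiv_of_hasCompactSupport hρ.contDiff
    hρ.hasCompactSupport
  obtain ⟨M, hM0, hM, hMlip⟩ := exists_bound_hessian_of_hasCompactSupport hρ.contDiff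
    hρ.hasCompactSupport
  set q : ℝ := (Fintype.card ι : ℝ) with hq
  have hq0 : 0 ≤ q := by positivity
  have hK0 : 0 ≤ (q + 4) * M / c := by positivity
  set K := (q + 4) * M / c with hK
  refine ⟨K + (K * (q * L₁) + q * M) * C₁, by positivity, N, hN, hfN, fun x hx hxΩ w hw => ?_⟩
  -- The frame `w` is tested at `y`, where it need not be tangent; Lipschitz bounds for `dρ` and
  -- `D²ρ` carry the estimate back to `x` with error `O(|ρ x|)`.
  obtain ⟨y, hy, hxy⟩ := hnear x hx hxΩ
  have h1 := sum_apply_ge_of_nonneg_on_ker (hρ.fderiv_ne_zero y hy)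
    (hM y) (hpos y hy) hw
  have h2 : ∀ i, fderiv ℝ (fderiv ℝ ρ) y (w i) (w i) - M * ‖x - y‖
      ≤ fderiv ℝ (fderiv ℝ ρ) x (w i) (w i) := fun i => by
    have e := (abs_le.1 (hMlip x y (w i))).1
    rw [hw.1 i, mul_one, mul_one] at e
    linarith
  have h3 : ∀ i, |fderiv ℝ ρ y (w i)| ≤ |fderiv ℝ ρ x (w i)| + L₁ * ‖x - y‖ := fun i => by
    have e := hL₁ y x (w i)
    rw [hw.1 i, mul_one, norm_sub_rev y x] at e
    have := abs_sub_abs_le_abs_sub (fderiv ℝ ρ y (w i)) (fderiv ℝ ρ x (w i))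
    linarith
  have h2' := Finset.sum_le_sum fun i (_ : i ∈ Finset.univ) => h2 i
  have h3' := Finset.sum_le_sum fun i (_ : i ∈ Finset.univ) => h3 i
  simp only [Finset.sum_sub_distrib, Finset.sum_add_distrib, Finset.sum_const, Finset.card_univ,
    nsmul_eq_mul, ← hq] at h2' h3'
  set S := ∑ i, |fderiv ℝ ρ x (w i)| with hS
  have hS0 : 0 ≤ S := Finset.sum_nonneg fun _ _ => abs_nonneg _
  have h4 : (q + 4) * M / ‖fderiv ℝ ρ y‖ * ∑ i, |fderiv ℝ ρ y (w i)|
      ≤ K * (S + q * (L₁ * ‖x - y‖)) := by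
    have : (q + 4) * M / ‖fderiv ℝ ρ y‖ ≤ K :=
      div_le_div_of_nonneg_left (by positivity) hc0 (hcf y hy).le
    gcongr
  have h5 : K * (S + q * (L₁ * ‖x - y‖)) + q * (M * ‖x - y‖)
      = K * S + (K * (q * L₁) + q * M) * ‖x - y‖ := by ring
  have h6 : (K * (q * L₁) + q * M) * ‖x - y‖ ≤ (K * (q * L₁) + q * M) * (C₁ * |ρ x|) := by
    gcongr
  have h7 : 0 ≤ K * |ρ x| := by positivity
  have h8 : 0 ≤ (K * (q * L₁) + q * M) * C₁ * S := by positivity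
  have h9 : (K + (K * (q * L₁) + q * M) * C₁) * (|ρ x| + S) = K * |ρ x| + K * S
      + (K * (q * L₁) + q * M) * (C₁ * |ρ x|) + (K * (q * L₁) + q * M) * C₁ * S := by ring
  rw [h9]
  linarith

end Distance

/-! ### The logarithmic barrier and `p`-convexity -/

section Barrier

variable {n p : ℕ} {Ω : Set (EuclideanSpace ℝ (Fin n))} {ρ : EuclideanSpace ℝ (Fin n) → ℝ}

/-- An open set with compact closure carrying a smooth `p`-plurisubharmonic function which blows
up at the boundary is `p`-convex. -/
theorem SmoothPSH.pConvex_of_tendsto (hΩ : IsOpen Ω) (hc : IsCompact (closure Ω))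
    {u : EuclideanSpace ℝ (Fin n) → ℝ} (hu : SmoothPSH p Ω u)
    (hlim : ∀ x ∈ frontier Ω, Filter.Tendsto u (𝓝[Ω] x) Filter.atTop) : PConvex p Ω := by
  intro K hKΩ hK
  have hsub : pHull p Ω K ⊆ Ω := fun x hx => hx.1
  refine hc.of_isClosed_subset (isClosed_of_closure_subset fun x hx => ?_)
    (hsub.trans subset_closure)
  have hne : (𝓝[pHull p Ω K] x).NeBot := mem_closure_iff_nhdsWithin_neBot.1 hx
  have hxΩ : x ∈ Ω := by
    by_contra hxΩ
    have hfr : x ∈ frontier Ω := hΩ.frontier_eq ▸ ⟨closure_mono hsub hx, hxΩ⟩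
    obtain ⟨m, hm⟩ := (hK.image_of_continuousOn (hu.1.continuousOn.mono hKΩ)).bddAbove
    have h1 := ((hlim x hfr).mono_left (nhdsWithin_mono x hsub)).eventually_gt_atTop m
    obtain ⟨y, hy, hyH⟩ := (h1.and self_mem_nhdsWithin).exists
    have h2 : (u y : EReal) ≤ (m : EReal) := (hyH.2 u hu).trans <| iSup₂_le fun z hz => by
      exact_mod_cast hm ⟨z, hz, rfl⟩
    exact hy.not_ge (by exact_mod_cast h2)
  refine ⟨hxΩ, fun v hv => ?_⟩
  have hcont : Filter.Tendsto (fun y => (v y : EReal)) (𝓝[pHull p Ω K] x) (𝓝 (v x : EReal)) :=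
    (continuous_coe_real_ereal.tendsto _).comp
      ((hv.1.continuousOn.continuousAt (hΩ.mem_nhds hxΩ)).tendsto.mono_left nhdsWithin_le_nhds)
  refine le_of_tendsto hcont ?_
  filter_upwards [self_mem_nhdsWithin] with y hy using hy.2 v hv

theorem contDiffAt_neg_log_neg {t : ℝ} (ht : t < 0) {k : WithTop ℕ∞} :
    ContDiffAt ℝ k (fun s => -Real.log (-s)) t :=
  (contDiffAt_id.neg.log (by simpa using ht.ne)).neg

/-- `Real.log` is even, so the formula holds for every real `t`. -/
theorem deriv_neg_log_neg (t : ℝ) : deriv (fun s => -Real.log (-s)) t = -t⁻¹ := by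
  have : (fun s : ℝ => -Real.log (-s)) = fun s => -Real.log s := by
    funext s; rw [Real.log_neg_eq_log]
  rw [this, deriv.fun_neg, Real.deriv_log]

theorem deriv_deriv_neg_log_neg (t : ℝ) :
    deriv (deriv fun s => -Real.log (-s)) t = (t ^ 2)⁻¹ := by
  have : deriv (fun s => -Real.log (-s)) = fun t => -t⁻¹ := funext deriv_neg_log_neg
  rw [this, deriv.fun_neg, deriv_inv, neg_neg]

/-- The convexified logarithmic barrier of a defining function. -/
def logBarrier (ρ : EuclideanSpace ℝ (Fin n) → ℝ) (A : ℝ) (x : EuclideanSpace ℝ (Fin n)) : ℝ :=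
  -Real.log (-ρ x) + A * ‖x - 0‖ ^ 2

theorem contDiff_const_mul_norm_sub_sq (A : ℝ) {k : WithTop ℕ∞} :
    ContDiff ℝ k fun x : EuclideanSpace ℝ (Fin n) => A * ‖x - 0‖ ^ 2 :=
  contDiff_const.mul ((contDiff_id.sub contDiff_const).norm_sq ℝ)

theorem IsDefiningFunction.contDiffAt_logBarrier (hρ : IsDefiningFunction Ω ρ) (A : ℝ)
    {x : EuclideanSpace ℝ (Fin n)} (hx : x ∈ Ω) : ContDiffAt ℝ ∞ (logBarrier ρ A) x :=
  ((contDiffAt_neg_log_neg ((hρ.mem_iff x).1 hx)).comp x hρ.contDiff.contDiffAt).add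
    (contDiff_const_mul_norm_sub_sq A).contDiffAt

theorem IsDefiningFunction.hessian_logBarrier_apply (hρ : IsDefiningFunction Ω ρ) (A : ℝ)
    {x : EuclideanSpace ℝ (Fin n)} (hx : x ∈ Ω) (w : EuclideanSpace ℝ (Fin n)) :
    fderiv ℝ (fderiv ℝ (logBarrier ρ A)) x w w
      = fderiv ℝ (fderiv ℝ ρ) x w w / |ρ x| + (fderiv ℝ ρ x w / |ρ x|) ^ 2 + 2 * A * ‖w‖ ^ 2 := by
  have hneg := (hρ.mem_iff x).1 hx
  have hρ2 : ContDiffAt ℝ 2 ρ x := (hρ.contDiff.of_le (by norm_cast)).contDiffAt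
  have hl : ContDiffAt ℝ 2 (fun y => -Real.log (-ρ y)) x :=
    (contDiffAt_neg_log_neg hneg).comp x hρ2
  have e : logBarrier ρ A = fun x => -Real.log (-ρ x) + A * ‖x - 0‖ ^ 2 := rfl
  rw [e, hessian_add hl (contDiff_const_mul_norm_sub_sq A).contDiffAt, add_apply, add_apply,
    hessian_const_mul_norm_sub_sq,
    hessian_comp_apply (h := fun s => -Real.log (-s)) (contDiffAt_neg_log_neg hneg) hρ2,
    deriv_neg_log_neg, deriv_deriv_neg_log_neg, div_pow, sq_abs, abs_of_neg hneg]
  have := hneg.ne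
  field_simp

/-- With `tᵢ = |dρ(wᵢ)| / |ρ|`, the loss is `C + C ∑ tᵢ`. Since `tᵢ² ≥ C tᵢ - C²`, the squares leave
a deficit of at most `C + p C²`, covered by the quadratic contribution `2p (C + C²)` as `p ≥ 1`. -/
theorem IsDefiningFunction.sum_hessian_logBarrier_nonneg (hρ : IsDefiningFunction Ω ρ)
    (hp : 1 ≤ p) {C : ℝ} (hC : 0 ≤ C) {x : EuclideanSpace ℝ (Fin n)} (hx : x ∈ Ω)
    {w : Fin p → EuclideanSpace ℝ (Fin n)} (hw : Orthonormal ℝ w)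
    (h : -(C * (|ρ x| + ∑ i, |fderiv ℝ ρ x (w i)|)) ≤ ∑ i, fderiv ℝ (fderiv ℝ ρ) x (w i) (w i)) :
    0 ≤ ∑ i, fderiv ℝ (fderiv ℝ (logBarrier ρ (C + C ^ 2))) x (w i) (w i) := by
  have ha : 0 < |ρ x| := abs_pos.2 ((hρ.mem_iff x).1 hx).ne
  simp only [hρ.hessian_logBarrier_apply _ hx, hw.1, Finset.sum_add_distrib, ← Finset.sum_div,
    Finset.sum_const, Finset.card_univ, Fintype.card_fin, nsmul_eq_mul]
  have h1 : -(C * (1 + ∑ i, |fderiv ℝ ρ x (w i)| / |ρ x|))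
      ≤ (∑ i, fderiv ℝ (fderiv ℝ ρ) x (w i) (w i)) / |ρ x| := by
    rw [le_div_iff₀ ha, ← Finset.sum_div]
    refine le_trans (le_of_eq ?_) h
    field_simp
  have h2 : ∀ i, C * (|fderiv ℝ ρ x (w i)| / |ρ x|) - C ^ 2 ≤ (fderiv ℝ ρ x (w i) / |ρ x|) ^ 2 :=
    fun i => by
      have : (fderiv ℝ ρ x (w i) / |ρ x|) ^ 2 = (|fderiv ℝ ρ x (w i)| / |ρ x|) ^ 2 := by
        rw [div_pow, div_pow, sq_abs (fderiv ℝ ρ x (w i))]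
      rw [this]
      nlinarith [sq_nonneg (|fderiv ℝ ρ x (w i)| / |ρ x| - C / 2), sq_nonneg C]
  have h3 := Finset.sum_le_sum fun i (_ : i ∈ Finset.univ) => h2 i
  simp only [Finset.sum_sub_distrib, ← Finset.mul_sum, Finset.sum_const, Finset.card_univ,
    Fintype.card_fin, nsmul_eq_mul] at h3
  have hp' : (1 : ℝ) ≤ p := by exact_mod_cast hp
  nlinarith [mul_le_mul_of_nonneg_right hp' hC, mul_nonneg (zero_le_one.trans hp') (sq_nonneg C)]

theorem IsDefiningFunction.tendsto_logBarrier (hρ : IsDefiningFunction Ω ρ) (hΩ : IsOpen Ω)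
    {A : ℝ} (hA : 0 ≤ A) {x : EuclideanSpace ℝ (Fin n)} (hx : x ∈ frontier Ω) :
    Filter.Tendsto (logBarrier ρ A) (𝓝[Ω] x) Filter.atTop := by
  have h1 : Filter.Tendsto ρ (𝓝[Ω] x) (𝓝[≠] 0) := by
    refine tendsto_nhdsWithin_iff.2 ⟨?_, ?_⟩
    · have := hρ.contDiff.continuous.tendsto x
      rw [hρ.eq_zero hΩ hx] at this
      exact this.mono_left nhdsWithin_le_nhds
    · filter_upwards [self_mem_nhdsWithin] with y hy using ((hρ.mem_iff y).1 hy).ne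
  have h2 := Filter.tendsto_neg_atBot_atTop.comp (Real.tendsto_log_nhdsNE_zero.comp h1)
  refine Filter.tendsto_atTop_mono (fun y => ?_) h2
  have : 0 ≤ A * ‖y - 0‖ ^ 2 := by positivity
  simp only [Function.comp_apply, logBarrier, Real.log_neg_eq_log]
  linarith

/-- A bounded open set whose boundary is `p`-convex is `p`-convex. -/
theorem IsDefiningFunction.pConvex (hρ : IsDefiningFunction Ω ρ) (hp : 1 ≤ p) (hΩ : IsOpen Ω)
    (hc : IsCompact (closure Ω))
    (hpos : ∀ x ∈ frontier Ω, ∀ w : Fin p → EuclideanSpace ℝ (Fin n), Orthonormal ℝ w →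
      (∀ i, fderiv ℝ ρ x (w i) = 0) → 0 ≤ ∑ i, fderiv ℝ (fderiv ℝ ρ) x (w i) (w i)) :
    PConvex p Ω := by
  obtain ⟨C, hC, N, hN, hfN, hbound⟩ := hρ.exists_sum_hessian_ge hΩ
    (hc.of_isClosed_subset isClosed_frontier frontier_subset_closure) hpos
  set v := logBarrier ρ (C + C ^ 2) with hv
  have hsmooth : ∀ x ∈ Ω, ContDiffAt ℝ ∞ v x := fun x hx => hρ.contDiffAt_logBarrier _ hx
  have hcore : IsCompact (closure Ω \ N) := hc.diff hN
  have hcoreΩ : closure Ω \ N ⊆ Ω := fun x hx => by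
    by_contra hxΩ
    exact hx.2 (hfN (hΩ.frontier_eq ▸ ⟨hx.1, hxΩ⟩))
  obtain ⟨T, hT⟩ := (hcore.image_of_continuousOn fun x hx =>
    (hsmooth x (hcoreΩ hx)).continuousAt.continuousWithinAt).bddAbove
  have hsm : ∀ x ∈ Ω, ContDiffAt ℝ ∞ (fun y => v y + -T) x := fun x hx =>
    (hsmooth x hx).add contDiffAt_const
  have hder : fderiv ℝ (fun y => v y + -T) = fderiv ℝ v := by
    funext x; exact fderiv_add_const _
  -- `v ≤ T` on `Ω` outside `N`, so the first derivative of the cutoff vanishes exactly where the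
  -- sign of the Hessian of `v` is uncontrolled.
  refine SmoothPSH.pConvex_of_tendsto hΩ hc (u := fun x => convexCutoff (v x + -T)) ⟨?_, ?_⟩ ?_
  · exact fun x hx => (contDiff_convexCutoff.contDiffAt.comp x (hsm x hx)).contDiffWithinAt
  · refine fun x hx => PPositive.of_sum_nonneg fun w hw => ?_
    have h2 : ContDiffAt ℝ 2 (fun y => v y + -T) x := (hsm x hx).of_le (by norm_cast)
    have h3 : ContDiffAt ℝ 2 convexCutoff (v x + -T) :=
      (contDiff_convexCutoff.of_le (by norm_cast)).contDiffAt
    simp only [hessian_comp_apply (f := fun y => v y + -T) h3 h2, hder, Finset.sum_add_distrib,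
      ← Finset.mul_sum]
    have hdd : 0 ≤ deriv (deriv convexCutoff) (v x + -T) * ∑ i, (fderiv ℝ v x (w i)) ^ 2 :=
      mul_nonneg (deriv_deriv_convexCutoff_nonneg _) (Finset.sum_nonneg fun i _ => sq_nonneg _)
    refine add_nonneg ?_ hdd
    by_cases hxN : x ∈ N
    · exact mul_nonneg (deriv_convexCutoff_nonneg _)
        (hρ.sum_hessian_logBarrier_nonneg hp hC hx hw (hbound x hxN hx w hw))
    · have hle : v x ≤ T := hT ⟨x, ⟨subset_closure hx, hxN⟩, rfl⟩
      rw [deriv_convexCutoff_of_nonpos (by linarith), zero_mul]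
  · intro x hx
    exact tendsto_convexCutoff_atTop.comp (Filter.tendsto_atTop_add_const_right _ (-T)
      (hρ.tendsto_logBarrier hΩ (by positivity) hx))

end Barrier

end PGeom

end

theorem theorem3p7 (n p : ℕ) (hp : 1 ≤ p) (hpn : p ≤ n)
    (Ω : Set (EuclideanSpace ℝ (Fin n))) (hopen : IsOpen Ω) (hcompact : IsCompact (closure Ω))
    (hsmooth : PGeom.HasSmoothBoundary Ω) (hloc : PGeom.LocallyPConvex p Ω) :
    PGeom.PConvex p Ω := by
  obtain ⟨ρ, hρ⟩ := hsmooth.exists_isDefiningFunction hopen hcompact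
  refine hρ.pConvex hp hopen hcompact fun x hx w hw hker => ?_
  obtain ⟨U, hU, hxU, hconv⟩ := hloc x hx
  exact hρ.sum_hessian_nonneg hopen hU hconv hx hxU hw hker
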